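/- Let $\mathcal G$ be a second countable, locally compact, Hausdorff, étale topological groupoid with unit space $\mathcal G^{(0)}$, source map $\mathfrak s$ and range map $\mathfrak r$, such that $\mathcal G^{(0)}$ is homeomorphic to the Cantor set. Suppose that $\mathcal G$ is minimal (for every $x\in\mathcal G^{(0)}$ the orbit $\{\mathfrak r(g) : \mathfrak s(g)=x\}$ is dense in $\mathcal G^{(0)}$) and effective (the interior of $\{g\in\mathcal G : \mathfrak s(g)=\mathfrak r(g)\}$ is $\mathcal G^{(0)}$). A bisection is a clopen set $U\subseteq\mathcal G$ such that $\mathfrak s|_U$ and $\mathfrak r|_U$ are homeomorphisms onto their images; it is global if $\mathfrak s(U)=\mathfrak r(U)=\mathcal G^{(0)}$. Suppose finally that $\mathcal G$ is purely infinite: for every clopen set $A\subseteq\mathcal G^{(0)}$ there are compact bisections $U,V\subseteq \mathcal G$ with $\mathfrak s(U)=\mathfrak s(V)=A$, $\mathfrak r(U)\cup\mathfrak r(V)\subseteq A$ and $\mathfrak r(U)\cap\mathfrak r(V)=\emptyset$. Let $\bm F(\mathcal G)$ be the topological full group of $\mathcal G$, i.e. the group of all global bisections under $UV=\{gh : g\in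 U,\ h\in V,\ \mathfrak s(g)=\mathfrak r(h)\}$ and $U^{-1}=\{g^{-1} : g\in U\}$, and let $\bm D(\mathcal G)=[\bm F(\mathcal G),\bm F(\mathcal G)]$ be its commutator subgroup. For a group $H$ let $\mathrm{Out}(H)=\mathrm{Aut}(H)/\mathrm{Inn}(H)$. Then restriction $\mathrm{res}\colon\mathrm{Aut}(\bm F(\mathcal G))\to\mathrm{Aut}(\bm D(\mathcal G))$, $\varphi\mapsto\varphi|_{\bm D(\mathcal G)}$, is bijective, and there is a short exact sequence of groups $$1\to\bm F(\mathcal G)/\bm D(\mathcal G)\xrightarrow{\ \iota\ }\mathrm{Out}(\bm D(\mathcal G))\xrightarrow{\ \pi\ }\mathrm{Out}(\bm F(\mathcal G))\to1,$$ where $\iota$ maps the class of $U\in\bm F(\mathcal G)$ to the class of the automorphism $W\mapsto UWU^{-1}$ of $\bm D(\mathcal G)$, and $\pi$ is the homomorphism induced by $\mathrm{res}^{-1}$, i.e. $\pi([\varphi|_{\bm D(\mathcal G)}])=[\varphi]$ for all $\varphi\in\mathrm{Aut}(\bm F(\mathcal G))$. -/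

import Mathlib

open CategoryTheory Topology

namespace AmpleGroupoid

/-! ### Topological groupoids

A groupoid is given by its unit space `X` with Mathlib's `Groupoid X` structure; the space of all
arrows is `Quiver.Total X`. The source of `g` is `g.left`, the range of `g` is `g.right`. -/

/-- The space of all arrows of a groupoid with unit space `X`. -/
abbrev Arr (X : Type*) [Groupoid X] := Quiver.Total X

section Algebra

variable {X : Type*} [Groupoid X]

/-- The identity arrow at `x`. -/
def unit (x : X) : Arr X := ⟨x, x, 𝟙 x⟩

/-- The inverse of an arrow. -/
def inv (g : Arr X) : Arr X := ⟨g.right, g.left, Groupoid.inv g.hom⟩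

/-- The product `gh` of arrows with source of `g` equal to range of `h` (first `h`, then `g`). -/
def mul (g h : Arr X) (e : g.left = h.right) : Arr X :=
  ⟨h.left, g.right, h.hom ≫ eqToHom e.symm ≫ g.hom⟩

@[simp] theorem unit_left (x : X) : (unit x).left = x := rfl
@[simp] theorem unit_right (x : X) : (unit x).right = x := rfl
@[simp] theorem inv_left (g : Arr X) : (inv g).left = g.right := rfl
@[simp] theorem inv_right (g : Arr X) : (inv g).right = g.left := rfl
@[simp] theorem mul_left (g h : Arr X) (e : g.left = h.right) : (mul g h e).left = h.left := rfl
@[simp] theorem mul_right (g h : Arr X) (e : g.left = h.right) : (mul g h e).right = g.right := rfl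

@[simp] theorem arr_inv_inv (g : Arr X) : inv (inv g) = g := by
  obtain ⟨a, b, f⟩ := g
  simp [inv]

theorem arr_mul_assoc (g h k : Arr X) (e : g.left = h.right) (e' : h.left = k.right) :
    mul (mul g h e) k e' = mul g (mul h k e') e := by
  obtain ⟨a, b, f⟩ := g
  obtain ⟨c, d, f'⟩ := h
  obtain ⟨i, j, f''⟩ := k
  dsimp only at e e'
  subst e e'
  change Quiver.Total.mk _ _ (f'' ≫ 𝟙 _ ≫ f' ≫ 𝟙 _ ≫ f) =
    Quiver.Total.mk _ _ ((f'' ≫ 𝟙 _ ≫ f') ≫ 𝟙 _ ≫ f)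
  simp

theorem arr_unit_mul (g : Arr X) (x : X) (e : x = g.right) : mul (unit x) g e = g := by
  obtain ⟨a, b, f⟩ := g
  dsimp only at e
  subst e
  change Quiver.Total.mk _ _ (f ≫ 𝟙 _ ≫ 𝟙 _) = Quiver.Total.mk _ _ f
  simp

theorem arr_mul_unit (g : Arr X) (x : X) (e : g.left = x) : mul g (unit x) e = g := by
  obtain ⟨a, b, f⟩ := g
  dsimp only at e
  subst e
  change Quiver.Total.mk _ _ (𝟙 _ ≫ 𝟙 _ ≫ f) = Quiver.Total.mk _ _ f
  simp

theorem arr_inv_mul (g : Arr X) : mul (inv g) g rfl = unit g.left := by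
  obtain ⟨a, b, f⟩ := g
  change Quiver.Total.mk _ _ (f ≫ 𝟙 _ ≫ Groupoid.inv f) = Quiver.Total.mk _ _ (𝟙 _)
  simp

theorem arr_mul_inv (g : Arr X) : mul g (inv g) rfl = unit g.right := by
  obtain ⟨a, b, f⟩ := g
  change Quiver.Total.mk _ _ (Groupoid.inv f ≫ 𝟙 _ ≫ f) = Quiver.Total.mk _ _ (𝟙 _)
  simp

/-- The product of two sets of arrows: all products `gh` with `g ∈ U`, `h ∈ V` composable. -/
def setMul (U V : Set (Arr X)) : Set (Arr X) :=
  {k | ∃ g ∈ U, ∃ h ∈ V, ∃ e : g.left = h.right, k = mul g h e}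

/-- The set of inverses of the elements of `U`. -/
def setInv (U : Set (Arr X)) : Set (Arr X) := inv '' U

end Algebra

section Topology

variable (X : Type*) [Groupoid X] [TopologicalSpace X] [TopologicalSpace (Arr X)]

/-- A topological groupoid: all structure maps are continuous. (Continuity of `unit` and of the
source map says that `X` carries the subspace topology when identified with the identity arrows.) -/
class IsTopologicalGroupoid : Prop where
  continuous_source : Continuous fun g : Arr X => g.left
  continuous_range : Continuous fun g : Arr X => g.right
  continuous_unit : Continuous (unit : X → Arr X)
  continuous_inv : Continuous (inv : Arr X → Arr X)
  continuous_mul : Continuous fun p : {p : Arr X × Arr X // p.1.left = p.2.right} =>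
    mul p.1.1 p.1.2 p.2

/-- An étale groupoid: source and range are local homeomorphisms. -/
class IsEtaleGroupoid : Prop extends IsTopologicalGroupoid X where
  isLocalHomeomorph_source : IsLocalHomeomorph fun g : Arr X => g.left
  isLocalHomeomorph_range : IsLocalHomeomorph fun g : Arr X => g.right

/-- A groupoid is minimal if every orbit is dense in the unit space. -/
def IsMinimal (X : Type*) [Groupoid X] [TopologicalSpace X] : Prop :=
  ∀ x : X, Dense {y : X | Nonempty (x ⟶ y)}

/-- A groupoid is effective if the interior of the isotropy is the set of identity arrows. -/
def IsEffective (X : Type*) [Groupoid X] [TopologicalSpace (Arr X)] : Prop :=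
  interior {g : Arr X | g.left = g.right} = Set.range (unit : X → Arr X)

variable {X}

/-- A clopen bisection: source and range restrict to homeomorphisms of `U` onto their images. -/
structure IsBisection (U : Set (Arr X)) : Prop where
  isClopen : IsClopen U
  isEmbedding_source : IsEmbedding (U.domRestrict fun g => g.left)
  isEmbedding_range : IsEmbedding (U.domRestrict fun g => g.right)

/-- A global bisection: a bisection whose source and range are the whole unit space. -/
structure IsGlobalBisection (U : Set (Arr X)) : Prop extends IsBisection U where
  source_eq : (fun g : Arr X => g.left) '' U = Set.univ
  range_eq : (fun g : Arr X => g.right) '' U = Set.univ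

/-- A subset `A` of the unit space is properly infinite if there are compact bisections `U`, `V`
with source `A` whose ranges are disjoint subsets of `A`. -/
def IsProperlyInfinite (A : Set X) : Prop :=
  ∃ U V : Set (Arr X), IsBisection U ∧ IsBisection V ∧ IsCompact U ∧ IsCompact V ∧
    (fun g : Arr X => g.left) '' U = A ∧ (fun g : Arr X => g.left) '' V = A ∧
    ((fun g : Arr X => g.right) '' U) ∪ ((fun g : Arr X => g.right) '' V) ⊆ A ∧
    Disjoint ((fun g : Arr X => g.right) '' U) ((fun g : Arr X => g.right) '' V)

variable (X) in
/-- A groupoid is purely infinite if every clopen subset of the unit space is properly infinite. -/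
def IsPurelyInfinite : Prop :=
  ∀ A : Set X, IsClopen A → IsProperlyInfinite A

/-- The section of the source map that a global bisection defines. -/
theorem IsGlobalBisection.exists_section {U : Set (Arr X)} (hU : IsGlobalBisection U) :
    ∃ (σ : X → Arr X) (φ : X ≃ₜ X), Continuous σ ∧ Set.range σ = U ∧
      (∀ x, (σ x).left = x) ∧ ∀ x, (σ x).right = φ x := by
  have hs : Function.Surjective (U.domRestrict fun g : Arr X => g.left) := fun x => by
    have hx : x ∈ (fun g : Arr X => g.left) '' U := hU.source_eq ▸ Set.mem_univ x
    obtain ⟨g, hg, rfl⟩ := hx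
    exact ⟨⟨g, hg⟩, rfl⟩
  have hr : Function.Surjective (U.domRestrict fun g : Arr X => g.right) := fun x => by
    have hx : x ∈ (fun g : Arr X => g.right) '' U := hU.range_eq ▸ Set.mem_univ x
    obtain ⟨g, hg, rfl⟩ := hx
    exact ⟨⟨g, hg⟩, rfl⟩
  let S := hU.isEmbedding_source.toHomeomorphOfSurjective hs
  let R := hU.isEmbedding_range.toHomeomorphOfSurjective hr
  refine ⟨fun x => (S.symm x : Arr X), S.symm.trans R,
    continuous_subtype_val.comp S.symm.continuous, ?_, fun x => ?_, fun x => rfl⟩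
  · ext g
    constructor
    · rintro ⟨x, rfl⟩
      exact (S.symm x).2
    · intro hg
      exact ⟨S ⟨g, hg⟩, by simp⟩
  · exact S.apply_symm_apply x

variable [IsTopologicalGroupoid X]

/-- A clopen set which is the image of a continuous section of the source map that covers a
homeomorphism is a global bisection. -/
theorem IsGlobalBisection.of_section {U : Set (Arr X)} (hU : IsClopen U) (σ : X → Arr X)
    (φ : X ≃ₜ X) (hσ : Continuous σ) (hσU : Set.range σ = U) (hl : ∀ x, (σ x).left = x)
    (hr : ∀ x, (σ x).right = φ x) : IsGlobalBisection U := by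
  subst hσU
  let S : X ≃ₜ Set.range σ :=
    { toFun := fun x => ⟨σ x, x, rfl⟩
      invFun := fun g => g.1.left
      left_inv := hl
      right_inv := by
        rintro ⟨_, x, rfl⟩
        simp [hl]
      continuous_toFun := hσ.subtype_mk _
      continuous_invFun := IsTopologicalGroupoid.continuous_source.comp continuous_subtype_val }
  have e1 : (Set.range σ).domRestrict (fun g : Arr X => g.left) = S.symm := rfl
  have e2 : (Set.range σ).domRestrict (fun g : Arr X => g.right) = S.symm.trans φ := by
    ext ⟨_, x, rfl⟩
    change (σ x).right = φ (σ x).left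
    rw [hr, hl]
  refine ⟨⟨hU, e1 ▸ S.symm.isEmbedding, e2 ▸ (S.symm.trans φ).isEmbedding⟩, ?_, ?_⟩
  · exact Set.eq_univ_of_forall fun x => ⟨σ x, ⟨x, rfl⟩, hl x⟩
  · exact Set.eq_univ_of_forall fun x => ⟨σ (φ.symm x), ⟨_, rfl⟩, by simp [hr]⟩

theorem continuous_mul' {Y : Type*} [TopologicalSpace Y] {a b : Y → Arr X} (ha : Continuous a)
    (hb : Continuous b) (e : ∀ y, (a y).left = (b y).right) :
    Continuous fun y => mul (a y) (b y) (e y) :=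
  (IsTopologicalGroupoid.continuous_mul (X := X)).comp
    (f := fun y => ⟨(a y, b y), e y⟩) ((ha.prodMk hb).subtype_mk _)

theorem IsGlobalBisection.setMul {U V : Set (Arr X)} (hU : IsGlobalBisection U)
    (hV : IsGlobalBisection V) : IsGlobalBisection (setMul U V) := by
  obtain ⟨σ, φ, hσ, rfl, hl, hr⟩ := hU.exists_section
  obtain ⟨τ, ψ, hτ, rfl, hl', hr'⟩ := hV.exists_section
  have hs := IsTopologicalGroupoid.continuous_source (X := X)
  refine IsGlobalBisection.of_section ?_
    (fun x => mul (σ (τ x).right) (τ x) (hl _)) (ψ.trans φ) ?_ ?_ ?_ ?_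
  · have e : AmpleGroupoid.setMul (Set.range σ) (Set.range τ) =
        (fun k : Arr X => mul k (inv (τ k.left)) (hl' _).symm) ⁻¹' Set.range σ := by
      ext k
      constructor
      · rintro ⟨g, hg, _, ⟨x, rfl⟩, e, rfl⟩
        have h2 : τ (mul g (τ x) e).left = τ x := by simp [hl']
        have : mul (mul g (τ x) e) (inv (τ (mul g (τ x) e).left)) (hl' _).symm = g := by
          simp only [h2]
          rw [arr_mul_assoc g (τ x) (inv (τ x)) e rfl]
          simp only [arr_mul_inv]
          exact arr_mul_unit _ _ e
        rw [Set.mem_preimage, this]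
        exact hg
      · intro hk
        refine ⟨_, hk, τ k.left, ⟨_, rfl⟩, rfl, ?_⟩
        rw [arr_mul_assoc k (inv (τ k.left)) (τ k.left) (hl' _).symm rfl]
        simp only [arr_inv_mul]
        exact (arr_mul_unit _ _ (hl' _).symm).symm
    rw [e]
    exact hU.isClopen.preimage (continuous_mul' continuous_id
      (IsTopologicalGroupoid.continuous_inv.comp (hτ.comp hs)) _)
  · exact continuous_mul' (hσ.comp (IsTopologicalGroupoid.continuous_range.comp hτ)) hτ _
  · ext k
    constructor
    · rintro ⟨x, rfl⟩
      exact ⟨_, ⟨_, rfl⟩, _, ⟨x, rfl⟩, _, rfl⟩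
    · rintro ⟨_, ⟨y, rfl⟩, _, ⟨x, rfl⟩, e, rfl⟩
      obtain rfl : y = (τ x).right := by rw [← e, hl]
      exact ⟨x, rfl⟩
  · exact fun x => hl' x
  · intro x
    simp [hr, hr']

theorem IsGlobalBisection.setInv {U : Set (Arr X)} (hU : IsGlobalBisection U) :
    IsGlobalBisection (setInv U) := by
  obtain ⟨σ, φ, hσ, rfl, hl, hr⟩ := hU.exists_section
  refine IsGlobalBisection.of_section ?_ (fun x => inv (σ (φ.symm x))) φ.symm ?_ ?_ ?_ ?_
  · have e : AmpleGroupoid.setInv (Set.range σ) = inv ⁻¹' Set.range σ :=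
      congrFun (Set.image_eq_preimage_of_inverse arr_inv_inv arr_inv_inv) _
    rw [e]
    exact hU.isClopen.preimage IsTopologicalGroupoid.continuous_inv
  · exact IsTopologicalGroupoid.continuous_inv.comp (hσ.comp φ.symm.continuous)
  · ext k
    constructor
    · rintro ⟨x, rfl⟩
      exact ⟨_, ⟨_, rfl⟩, rfl⟩
    · rintro ⟨_, ⟨x, rfl⟩, rfl⟩
      exact ⟨φ x, by simp⟩
  · intro x
    simp [hr]
  · intro x
    simp [hl]

end Topology

section FullGroup

variable (X : Type*) [Groupoid X] [TopologicalSpace X] [TopologicalSpace (Arr X)]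

theorem isGlobalBisection_unit [IsEtaleGroupoid X] [T2Space (Arr X)] :
    IsGlobalBisection (Set.range (unit : X → Arr X)) := by
  have hu := IsTopologicalGroupoid.continuous_unit (X := X)
  have hs := IsTopologicalGroupoid.continuous_source (X := X)
  refine IsGlobalBisection.of_section ⟨?_, ?_⟩ unit (Homeomorph.refl X) hu rfl
    (fun _ => rfl) (fun _ => rfl)
  · have e : Set.range (unit : X → Arr X) = {g | unit g.left = g} := by
      ext g
      constructor
      · rintro ⟨x, rfl⟩
        rfl
      · intro hg
        exact ⟨_, hg⟩
    rw [e]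
    exact isClosed_eq (hu.comp hs) continuous_id
  · rw [isOpen_iff_mem_nhds]
    rintro _ ⟨x, rfl⟩
    obtain ⟨W, hxW, hW⟩ := IsEtaleGroupoid.isLocalHomeomorph_source (X := X) (unit x)
    have h1 : W.source ∈ 𝓝 (unit x) := W.open_source.mem_nhds hxW
    have h2 : (fun g : Arr X => unit g.left) ⁻¹' W.source ∈ 𝓝 (unit x) :=
      (hu.comp hs).continuousAt.preimage_mem_nhds h1
    filter_upwards [h1, h2] with g hg hg'
    refine ⟨g.left, W.injOn hg' hg ?_⟩
    rw [← hW]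
    rfl

/-- The topological full group: the group of all global bisections. -/
@[ext]
structure FullGroup where
  /-- the underlying set of arrows -/
  carrier : Set (Arr X)
  isGlobalBisection : IsGlobalBisection carrier

variable [IsEtaleGroupoid X] [T2Space (Arr X)]

/-- The group structure: product and inverse of global bisections as sets of arrows. -/
instance : Group (FullGroup X) where
  mul U V := ⟨setMul U.carrier V.carrier, U.isGlobalBisection.setMul V.isGlobalBisection⟩
  one := ⟨Set.range unit, isGlobalBisection_unit X⟩
  inv U := ⟨setInv U.carrier, U.isGlobalBisection.setInv⟩
  mul_assoc U V W := by
    apply FullGroup.ext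
    change setMul (setMul U.carrier V.carrier) W.carrier = setMul U.carrier (setMul V.carrier W.carrier)
    ext k
    constructor
    · rintro ⟨_, ⟨g, hg, h, hh, e, rfl⟩, l, hl, e', rfl⟩
      exact ⟨g, hg, mul h l e', ⟨h, hh, l, hl, e', rfl⟩, e, arr_mul_assoc g h l e e'⟩
    · rintro ⟨g, hg, _, ⟨h, hh, l, hl, e', rfl⟩, e, rfl⟩
      exact ⟨mul g h e, ⟨g, hg, h, hh, e, rfl⟩, l, hl, e', (arr_mul_assoc g h l e e').symm⟩
  one_mul U := by
    apply FullGroup.ext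
    change setMul (Set.range unit) U.carrier = U.carrier
    ext k
    constructor
    · rintro ⟨_, ⟨x, rfl⟩, h, hh, e, rfl⟩
      have e' : x = h.right := e
      rwa [arr_unit_mul _ _ e']
    · intro hk
      exact ⟨unit k.right, ⟨_, rfl⟩, k, hk, rfl, (arr_unit_mul _ _ rfl).symm⟩
  mul_one U := by
    apply FullGroup.ext
    change setMul U.carrier (Set.range unit) = U.carrier
    ext k
    constructor
    · rintro ⟨h, hh, _, ⟨x, rfl⟩, e, rfl⟩
      have e' : h.left = x := e
      rwa [arr_mul_unit _ _ e']
    · intro hk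
      exact ⟨k, hk, unit k.left, ⟨_, rfl⟩, rfl, (arr_mul_unit _ _ rfl).symm⟩
  inv_mul_cancel U := by
    apply FullGroup.ext
    change setMul (setInv U.carrier) U.carrier = Set.range unit
    obtain ⟨σ, φ, hσ, hU, hl, hr⟩ := U.isGlobalBisection.exists_section
    rw [← hU]
    ext k
    constructor
    · rintro ⟨_, ⟨_, ⟨x, rfl⟩, rfl⟩, _, ⟨y, rfl⟩, e, rfl⟩
      obtain rfl : x = y := φ.injective (by rw [← hr, ← hr]; exact e)
      exact ⟨_, (arr_inv_mul (σ x)).symm⟩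
    · rintro ⟨x, rfl⟩
      refine ⟨inv (σ x), ⟨_, ⟨x, rfl⟩, rfl⟩, σ x, ⟨x, rfl⟩, rfl, ?_⟩
      rw [arr_inv_mul, hl]

end FullGroup

section Out

variable (G : Type*) [Group G]

/-- The inner automorphisms of a group. -/
def innerAut : Subgroup (MulAut G) := (MulAut.conj : G →* MulAut G).range

instance innerAut_normal : (innerAut G).Normal := by
  constructor
  rintro _ ⟨g, rfl⟩ φ
  refine ⟨φ g, ?_⟩
  ext h
  simp

/-- The outer automorphism group of a group. -/
abbrev OuterAut : Type _ := MulAut G ⧸ innerAut G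

/-- The canonical map `G ⧸ [G, G] → Out([G, G])`: the class of `g` is sent to the class of the
conjugation by `g`, restricted to the commutator subgroup. -/
def conjOut : G ⧸ commutator G →* OuterAut (commutator G) :=
  QuotientGroup.lift (commutator G)
    ((QuotientGroup.mk' (innerAut (commutator G))).comp MulAut.conjNormal) (by
      intro g hg
      refine (QuotientGroup.eq_one_iff _).2 ⟨⟨g, hg⟩, ?_⟩
      ext h
      simp)

end Out

end AmpleGroupoid

/-! Write `F` for the full group and `D` for its commutator subgroup, both acting on the unit space
`X`. Two facts carry the theorem.

The centralizer of `D` in `F` is trivial, because `D` contains elements that move a given point and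
are supported in any given neighbourhood of it (`eq_one_of_commute_commutator`). Hence an
automorphism of `F` is determined on `D`, and `F / D` embeds in `Out(D)`.

Every automorphism `ψ` of `D` extends to `F` (`exists_extension`). By a Rubin-type argument `ψ` is
conjugation by a homeomorphism `h` of `X`: inclusion of closed supports can be read off from the
group, so `ψ` respects it, and points are recovered from the supports that contain them
(`IsLocallyRich.exists_homeomorph`). Near each point an element of `F` agrees with an element of `D`
(`exists_commutator_eventuallyEq`), so `h f h⁻¹` agrees locally with elements of `D`. As `F`
contains every homeomorphism that is locally in `F`, `h` normalizes `F`.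

The exact sequence is then formal: under `Aut(F) ≅ Aut(D)` the group `Inn(F)` becomes the
conjugations of `D` by `F`, which contain `Inn(D)`.

The groupoid enters through `IsFullAction` and faithfulness. Effectiveness makes arrows depend only
on germs of the action; pure infiniteness puts other points of the orbit near every unit. -/

/-! ### Supports and their algebraic description -/

section Reconstruction

open scoped commutatorElement

/-- The closed support of a group element acting on a topological space. -/
def closedSupport {G : Type*} [Group G] (X : Type*) [TopologicalSpace X] [MulAction G X] (g : G) :
    Set X :=
  closure {x | g • x ≠ x}

/-- An action whose closed supports are open, and in which every neighbourhood of every point `x`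
supports an element of order five that moves `x`. -/
structure IsLocallyRich (G X : Type*) [Group G] [TopologicalSpace X] [MulAction G X] : Prop where
  isOpen_closedSupport : ∀ g : G, IsOpen (closedSupport X g)
  exists_pow_five : ∀ x : X, ∀ A ∈ 𝓝 x, ∃ g : G, g ^ 5 = 1 ∧ g • x ≠ x ∧ ∀ y ∉ A, g • y = y

/-- The relation of algebraic disjointness from the proof of Rubin's theorem. -/
def AlgDisjoint {G : Type*} [Group G] (f g : G) : Prop :=
  ∀ h, ¬ Commute f h → ∃ f₁ f₂, Commute f₁ g ∧ Commute f₂ g ∧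
    ⁅⁅h, f₁⁆, f₂⁆ ≠ 1 ∧ Commute ⁅⁅h, f₁⁆, f₂⁆ g

theorem AlgDisjoint.map {G H : Type*} [Group G] [Group H] (ψ : G ≃* H) {f g : G}
    (hfg : AlgDisjoint f g) : AlgDisjoint (ψ f) (ψ g) := by
  intro h hh
  obtain ⟨f₁, f₂, h₁, h₂, h₃, h₄⟩ := hfg (ψ.symm h) fun hc => hh (by simpa using hc.map ψ)
  refine ⟨ψ f₁, ψ f₂, h₁.map ψ, h₂.map ψ, ?_, ?_⟩
  · intro e
    apply h₃
    apply ψ.injective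
    simpa [commutatorElement_def] using e
  · simpa [commutatorElement_def] using h₄.map ψ

theorem algDisjoint_map_iff {G H : Type*} [Group G] [Group H] (ψ : G ≃* H) {f g : G} :
    AlgDisjoint (ψ f) (ψ g) ↔ AlgDisjoint f g :=
  ⟨fun h => by simpa using h.map ψ.symm, fun h => h.map ψ⟩

section Support

variable {G X : Type*} [Group G] [TopologicalSpace X] [MulAction G X]

theorem mem_closedSupport_of_smul_ne {g : G} {x : X} (h : g • x ≠ x) : x ∈ closedSupport X g :=
  subset_closure h

theorem smul_eq_of_notMem_closedSupport {g : G} {x : X} (h : x ∉ closedSupport X g) : g • x = x :=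
  not_not.1 fun h' => h (mem_closedSupport_of_smul_ne h')

theorem exists_smul_ne_of_isOpen {g : G} {x : X} {U : Set X} (hU : IsOpen U) (hx : x ∈ U)
    (hg : x ∈ closedSupport X g) : ∃ y ∈ U, g • y ≠ y :=
  mem_closure_iff.1 hg U hU hx

theorem closedSupport_subset {g : G} {A : Set X} (hA : IsClosed A) (h : ∀ y ∉ A, g • y = y) :
    closedSupport X g ⊆ A :=
  closure_minimal (fun y hy => not_not.1 fun hyA => hy (h y hyA)) hA

theorem isOpen_setOf_smul_ne [T2Space X] [ContinuousConstSMul G X] (g : G) :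
    IsOpen {x : X | g • x ≠ x} :=
  isOpen_ne_fun (continuous_const_smul g) continuous_id

theorem smul_mem_closedSupport_iff [ContinuousConstSMul G X] (f g : G) (x : X) :
    g • x ∈ closedSupport X f ↔ x ∈ closedSupport X (g⁻¹ * f * g) := by
  have : {z : X | (g⁻¹ * f * g) • z ≠ z} = (Homeomorph.smul g) ⁻¹' {z : X | f • z ≠ z} := by
    ext w
    simp [mul_smul, inv_smul_eq_iff]
  rw [closedSupport, closedSupport, this, ← Homeomorph.preimage_closure]
  rfl

theorem inv_smul_eq_of_smul_eq {g : G} {x : X} (h : g • x = x) : g⁻¹ • x = x :=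
  inv_smul_eq_iff.2 h.symm

theorem commute_of_forall_smul_eq_or [FaithfulSMul G X] {f g : G}
    (h : ∀ x : X, f • x = x ∨ g • x = x) : Commute f g := by
  apply eq_of_smul_eq_smul (α := X)
  intro x
  rw [mul_smul, mul_smul]
  rcases h x with hf | hg
  · rw [hf]
    rcases h (g • x) with h' | h'
    · exact h'
    · rw [smul_left_cancel_iff] at h'
      rw [h', hf]
  · rw [hg]
    rcases h (f • x) with h' | h'
    · rw [smul_left_cancel_iff] at h'
      rw [h', hg]
    · exact h'.symm

theorem exists_smul_eq_forall_ne_of_ne [T2Space X] [ContinuousConstSMul G X] {f : G} {x : X}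
    (h : f • x ≠ x) {A : Set X} (hA : A ∈ 𝓝 x) :
    ∃ U ⊆ A, IsOpen U ∧ x ∈ U ∧ ∀ y ∈ U, f • y ∉ U := by
  obtain ⟨P, Q, hP, hQ, hxP, hxQ, hPQ⟩ := t2_separation h
  obtain ⟨B, hBA, hB, hxB⟩ := mem_nhds_iff.1 hA
  refine ⟨B ∩ (Q ∩ (f • ·) ⁻¹' P), fun y hy => hBA hy.1,
    hB.inter (hQ.inter (hP.preimage (continuous_const_smul f))), ⟨hxB, hxQ, hxP⟩, ?_⟩
  exact fun y hy hy' => hPQ.le_bot ⟨hy.2.2, hy'.2.1⟩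

end Support

namespace IsLocallyRich

variable {G X : Type*} [Group G] [TopologicalSpace X] [MulAction G X]
  [T2Space X] [ContinuousConstSMul G X] [FaithfulSMul G X]

/-- Choose `f₂` moving `x` and supported away from `f₁ • x`: commuting would force `f₂` to fix `x`.
-/
theorem exists_not_commute (hG : IsLocallyRich G X) {x : X} {A : Set X} (hA : A ∈ 𝓝 x) :
    ∃ f₁ f₂ : G, (∀ y ∉ A, f₁ • y = y) ∧ (∀ y ∉ A, f₂ • y = y) ∧ ¬ Commute f₁ f₂ := by
  obtain ⟨f₁, -, h₁, h₁'⟩ := hG.exists_pow_five x A hA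
  obtain ⟨f₂, -, h₂, h₂'⟩ := hG.exists_pow_five x (A ∩ {f₁ • x}ᶜ)
    (Filter.inter_mem hA (isOpen_compl_singleton.mem_nhds h₁.symm))
  refine ⟨f₁, f₂, h₁', fun y hy => h₂' y fun h => hy h.1, fun hc => h₂ ?_⟩
  have := congrArg (· • x) hc.eq
  simp only [mul_smul] at this
  rw [h₂' (f₁ • x) (by simp)] at this
  exact smul_left_cancel _ this

/-- Near a point moved by both `f` and `h` there is an open `U` inside the support of `f` with `h U`
disjoint from `U`. For `f₁`, `f₂` supported in `U`, the conjugate `h f₁ h⁻¹` lives on `h U` and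
cancels from the double commutator, leaving a commutator of `f₁⁻¹` and `f₂`, supported off the
support of `g`. -/
theorem algDisjoint_of_disjoint (hG : IsLocallyRich G X) {f g : G}
    (hfg : Disjoint (closedSupport X f) (closedSupport X g)) : AlgDisjoint f g := by
  intro h hh
  obtain ⟨x, hfx, hhx⟩ : ∃ x : X, f • x ≠ x ∧ h • x ≠ x := by
    by_contra! hc
    exact hh (commute_of_forall_smul_eq_or (X := X) fun x => or_iff_not_imp_left.2 (hc x))
  obtain ⟨U, hUf, hU, hxU, hUh⟩ := exists_smul_eq_forall_ne_of_ne hhx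
    ((hG.isOpen_closedSupport f).mem_nhds (mem_closedSupport_of_smul_ne hfx))
  obtain ⟨f₁, f₂, h₁, h₂, h₁₂⟩ := hG.exists_not_commute (hU.mem_nhds hxU)
  have key : ∀ k : G, (∀ y ∉ U, k • y = y) → Commute k g := fun k hk =>
    commute_of_forall_smul_eq_or (X := X) fun y => by
      by_cases hy : y ∈ U
      · exact Or.inr (smul_eq_of_notMem_closedSupport fun hyg => hfg.le_bot ⟨hUf hy, hyg⟩)
      · exact Or.inl (hk y hy)
  have hp : ∀ k : G, (∀ y ∉ U, k • y = y) → Commute (h * f₁ * h⁻¹) k := fun k hk =>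
    commute_of_forall_smul_eq_or (X := X) fun y => by
      by_cases hy : y ∈ U
      · left
        have : h⁻¹ • y ∉ U := fun hc => by simpa [hy] using hUh _ hc
        rw [mul_smul, mul_smul, h₁ _ this, smul_inv_smul]
      · exact Or.inr (hk y hy)
  have e : ⁅⁅h, f₁⁆, f₂⁆ = f₁⁻¹ * f₂ * f₁ * f₂⁻¹ := by
    have c₁ : Commute (h * f₁ * h⁻¹) (f₁⁻¹ * f₂ * f₁) :=
      ((hp f₁ h₁).inv_right.mul_right (hp f₂ h₂)).mul_right (hp f₁ h₁)
    calc ⁅⁅h, f₁⁆, f₂⁆ = (h * f₁ * h⁻¹) * (f₁⁻¹ * f₂ * f₁) * (h * f₁ * h⁻¹)⁻¹ * f₂⁻¹ := by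
          simp only [commutatorElement_def]; group
      _ = _ := by rw [c₁.eq]; group
  have k₁ := key f₁ h₁
  have k₂ := key f₂ h₂
  refine ⟨f₁, f₂, k₁, k₂, ?_, ?_⟩
  · rw [e]
    intro h0
    apply h₁₂
    have : f₂ * f₁ = f₁ * f₂ := by
      have := mul_inv_eq_one.1 h0
      rw [mul_assoc, inv_mul_eq_iff_eq_mul] at this
      exact this
    exact this.symm
  · rw [e]
    exact ((k₁.inv_left.mul_left k₂).mul_left k₁).mul_left k₂.inv_left

theorem _root_.pow_smul_ne_of_pow_five {g : G} (hg : g ^ 5 = 1) {x : X} (hx : g • x ≠ x)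
    {i j : Fin 5} (hij : i ≠ j) : g ^ (i : ℕ) • x ≠ g ^ (j : ℕ) • x := by
  have h5 : Function.minimalPeriod (g • ·) x = 5 := by
    have hp : Function.IsPeriodicPt (g • ·) 5 x := by
      rw [Function.IsPeriodicPt, Function.IsFixedPt, smul_iterate, hg]
      exact one_smul G x
    rcases (Nat.dvd_prime Nat.prime_five).1 hp.minimalPeriod_dvd with h | h
    · exact absurd (Function.minimalPeriod_eq_one_iff_isFixedPt.1 h) hx
    · exact h
  intro e
  apply hij
  have := (Function.iterate_eq_iterate_iff_of_lt_minimalPeriod (f := (g • · : X → X)) (x := x)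
    (m := i) (n := j) (by omega) (by omega)).1 (by simpa only [smul_iterate] using e)
  exact Fin.ext this

theorem _root_.exists_isOpen_forall_smul_ne {n : ℕ} (f : Fin n → G) {x : X}
    (hf : Function.Injective fun i => f i • x) :
    ∃ U : Set X, IsOpen U ∧ x ∈ U ∧ ∀ i j, i ≠ j → ∀ y ∈ U, ∀ z ∈ U, f i • y ≠ f j • z := by
  obtain ⟨W, hW, hd⟩ := (Set.finite_range fun i => f i • x).t2_separation
  refine ⟨⋂ i, (f i • ·) ⁻¹' W (f i • x), isOpen_iInter_of_finite fun i =>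
    (hW _).2.preimage (continuous_const_smul _), Set.mem_iInter.2 fun i => (hW _).1, ?_⟩
  intro i j hij y hy z hz e
  refine (hd ⟨i, rfl⟩ ⟨j, rfl⟩ (hf.ne hij)).le_bot
    ⟨Set.mem_iInter.1 hy i, ?_⟩
  simp only [e]
  exact Set.mem_iInter.1 hz j

/-- Five against four: the double commutator `k` moves only points in four translates of `U`, but
commutes with `g`, so it moves all five points of some `g`-orbit. Two of these lie in one translate,
although the sets `g ^ i U` are disjoint. Primality of five makes every nontrivial orbit of `g` have
exactly five points. -/
theorem disjoint_of_algDisjoint (hG : IsLocallyRich G X) {f g : G} (hg : g ^ 5 = 1)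
    (hfg : AlgDisjoint f g) : Disjoint (closedSupport X f) (closedSupport X g) := by
  rw [Set.disjoint_iff_inter_eq_empty, ← Set.not_nonempty_iff_eq_empty]
  rintro ⟨x₀, hx₀⟩
  obtain ⟨x₁, hx₁, hfx₁⟩ := exists_smul_ne_of_isOpen
    ((hG.isOpen_closedSupport f).inter (hG.isOpen_closedSupport g)) hx₀ hx₀.1
  obtain ⟨x, hfx, hgx⟩ := exists_smul_ne_of_isOpen (isOpen_setOf_smul_ne f) hfx₁ hx₁.2
  obtain ⟨W, hW, hxW, hdis⟩ := exists_isOpen_forall_smul_ne (fun i : Fin 5 => g ^ (i : ℕ))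
    (x := x) fun i j e => by_contra fun hij => pow_smul_ne_of_pow_five hg hgx hij e
  obtain ⟨U, hUW, hU, hxU, hUf⟩ := exists_smul_eq_forall_ne_of_ne hfx (hW.mem_nhds hxW)
  obtain ⟨h, -, hhx, hhU⟩ := hG.exists_pow_five x U (hU.mem_nhds hxU)
  obtain ⟨f₁, f₂, c₁, c₂, hk, ck⟩ := hfg h fun hc => by
    have := congrArg (· • x) hc.eq
    simp only [mul_smul] at this
    rw [hhU _ (hUf x hxU)] at this
    exact hhx (smul_left_cancel _ this)
  set k := ⁅⁅h, f₁⁆, f₂⁆ with hkdef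
  obtain ⟨y, hy⟩ : ∃ y : X, k • y ≠ y := by
    by_contra! hc
    exact hk (eq_of_smul_eq_smul (α := X) fun y => by simp [hc y])
  -- Written out, `k` contains `h` or `h⁻¹` four times; these are the prefixes that carry `U` to the
  -- places where those letters act.
  let u : Fin 4 → G := ![1, f₁, f₂, f₂ * f₁]
  have hu : ∀ a, Commute (u a) g := by
    intro a
    fin_cases a
    · exact Commute.one_left g
    · exact c₁
    · exact c₂
    · exact c₂.mul_left c₁
  have hmem : ∀ z : X, k • z ≠ z → ∃ a, (u a)⁻¹ • z ∈ U := by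
    intro z hz
    by_contra! hc
    apply hz
    have a0 : h • z = z := hhU z (by simpa [u] using hc 0)
    have a1 : h • f₁⁻¹ • z = f₁⁻¹ • z := hhU _ (by simpa [u] using hc 1)
    have a2 : h⁻¹ • f₂⁻¹ • z = f₂⁻¹ • z := inv_smul_eq_of_smul_eq (hhU _ (by simpa [u] using hc 2))
    have a3 : h • f₁⁻¹ • f₂⁻¹ • z = f₁⁻¹ • f₂⁻¹ • z :=
      hhU _ (by simpa [u, mul_smul] using hc 3)
    have a1' := inv_smul_eq_of_smul_eq a1
    have e : k = h * f₁ * h⁻¹ * f₁⁻¹ * f₂ * f₁ * h * f₁⁻¹ * h⁻¹ * f₂⁻¹ := by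
      rw [hkdef]; simp only [commutatorElement_def]; group
    rw [e]
    simp only [mul_smul]
    rw [a2, a3, smul_inv_smul, smul_inv_smul, a1', smul_inv_smul, a0]
  have hky : ∀ i : ℕ, k • g ^ i • y ≠ g ^ i • y := by
    intro i e
    apply hy
    rw [← mul_smul, (ck.pow_right i).eq, mul_smul] at e
    exact smul_left_cancel _ e
  choose a ha using fun i : Fin 5 => hmem _ (hky i)
  obtain ⟨i, j, hij, haij⟩ := Fintype.exists_ne_map_eq_of_card_lt a (by simp)
  have hi := ha i
  have hj := ha j
  rw [haij] at hi
  refine hdis i j hij _ (hUW hj) _ (hUW hi) ?_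
  have cc : ∀ m : ℕ, Commute (g ^ m) (u (a j))⁻¹ := fun m => ((hu (a j)).inv_left.pow_right m).symm
  simp only [← mul_smul]
  rw [← (cc j).eq, ← (cc i).eq, ← mul_assoc, ← mul_assoc, ← pow_add, ← pow_add, add_comm]

/-- This makes inclusion of supports a group-theoretic relation. If `k` moves a point off the
support of `f`, a small element of order five there is disjoint from `f` and does not commute with
`k`. -/
theorem closedSupport_subset_iff (hG : IsLocallyRich G X) {f k : G} :
    closedSupport X k ⊆ closedSupport X f ↔
      ∀ g : G, g ^ 5 = 1 → AlgDisjoint f g → Commute k g := by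
  constructor
  · intro h g hg hfg
    have hd := hG.disjoint_of_algDisjoint hg hfg
    refine commute_of_forall_smul_eq_or (X := X) fun x => ?_
    by_cases hx : x ∈ closedSupport X f
    · exact Or.inr (smul_eq_of_notMem_closedSupport fun hxg => hd.le_bot ⟨hx, hxg⟩)
    · exact Or.inl (smul_eq_of_notMem_closedSupport fun hxk => hx (h hxk))
  · intro h
    by_contra hc
    obtain ⟨x₀, hk, hf⟩ := Set.not_subset.1 hc
    obtain ⟨x, hxf, hkx⟩ := exists_smul_ne_of_isOpen
      (isClosed_closure.isOpen_compl (s := closedSupport X f)) hf hk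
    have hS : IsClosed (closedSupport X f)ᶜ := (hG.isOpen_closedSupport f).isClosed_compl
    obtain ⟨U, hUf, hU, hxU, hUk⟩ := exists_smul_eq_forall_ne_of_ne hkx
      ((isClosed_closure.isOpen_compl (s := closedSupport X f)).mem_nhds hxf)
    obtain ⟨g, hg, hgx, hgU⟩ := hG.exists_pow_five x U (hU.mem_nhds hxU)
    have hd : Disjoint (closedSupport X f) (closedSupport X g) :=
      (disjoint_compl_right).mono_right
        (closedSupport_subset hS fun y hy => hgU y fun hyU => hy (hUf hyU))
    have := congrArg (· • x) (h g hg (hG.algDisjoint_of_disjoint hd)).eq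
    simp only [mul_smul] at this
    rw [hgU _ (hUk x hxU)] at this
    exact hgx (smul_left_cancel _ this)

theorem exists_mem_closedSupport_subset [CompactSpace X] [TotallyDisconnectedSpace X]
    (hG : IsLocallyRich G X) {x : X} {A : Set X} (hA : A ∈ 𝓝 x) :
    ∃ g : G, x ∈ closedSupport X g ∧ closedSupport X g ⊆ A := by
  obtain ⟨B, hBA, hB, hxB⟩ := mem_nhds_iff.1 hA
  obtain ⟨V, hV, hxV, hVB⟩ := compact_exists_isClopen_in_isOpen hB hxB
  obtain ⟨g, -, hgx, hg⟩ := hG.exists_pow_five x V (hV.isOpen.mem_nhds hxV)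
  exact ⟨g, mem_closedSupport_of_smul_ne hgx,
    (closedSupport_subset hV.isClosed hg).trans (hVB.trans hBA)⟩

theorem eq_of_forall_mem_closedSupport [CompactSpace X] [TotallyDisconnectedSpace X]
    (hG : IsLocallyRich G X) {x y : X}
    (h : ∀ g : G, x ∈ closedSupport X g → y ∈ closedSupport X g) : x = y := by
  by_contra hxy
  obtain ⟨g, hx, hg⟩ := hG.exists_mem_closedSupport_subset
    (isOpen_compl_singleton (x := y) |>.mem_nhds hxy)
  exact hg (h g hx) rfl

/-- Disjointness reduces to inclusion, since supports are open and contain small supports around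
each of their points. -/
theorem disjoint_closedSupport_iff [CompactSpace X] [TotallyDisconnectedSpace X]
    (hG : IsLocallyRich G X) {f g : G} :
    Disjoint (closedSupport X f) (closedSupport X g) ↔ ∀ k : G,
      closedSupport X k ⊆ closedSupport X f → closedSupport X k ⊆ closedSupport X g → k = 1 := by
  constructor
  · intro h k hf hg
    refine eq_of_smul_eq_smul (α := X) fun x => ?_
    rw [one_smul]
    exact smul_eq_of_notMem_closedSupport fun hx => h.le_bot ⟨hf hx, hg hx⟩
  · intro h
    rw [Set.disjoint_left]
    intro x hf hg
    obtain ⟨k, hxk, hk⟩ := hG.exists_mem_closedSupport_subset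
      (((hG.isOpen_closedSupport f).inter (hG.isOpen_closedSupport g)).mem_nhds ⟨hf, hg⟩)
    have := h k (fun y hy => (hk hy).1) fun y hy => (hk hy).2
    subst this
    simp [closedSupport] at hxk

end IsLocallyRich

/-! ### Isomorphisms of locally rich groups are spatial -/

section TwoActions

variable {G X H Y : Type*} [Group G] [TopologicalSpace X] [MulAction G X]
  [CompactSpace X] [T2Space X] [TotallyDisconnectedSpace X]
  [ContinuousConstSMul G X] [FaithfulSMul G X]
  [Group H] [TopologicalSpace Y] [MulAction H Y]
  [CompactSpace Y] [T2Space Y] [TotallyDisconnectedSpace Y]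
  [ContinuousConstSMul H Y] [FaithfulSMul H Y]

theorem IsLocallyRich.closedSupport_map_subset_iff (hG : IsLocallyRich G X)
    (hH : IsLocallyRich H Y) (ψ : G ≃* H) {f k : G} :
    closedSupport Y (ψ k) ⊆ closedSupport Y (ψ f) ↔ closedSupport X k ⊆ closedSupport X f := by
  rw [hG.closedSupport_subset_iff, hH.closedSupport_subset_iff, ψ.surjective.forall]
  refine forall_congr' fun g => ?_
  rw [algDisjoint_map_iff, ← map_pow, map_eq_one_iff _ ψ.injective]
  refine imp_congr_right fun _ => imp_congr_right fun _ =>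
    ⟨fun h => by simpa using h.map ψ.symm, fun h => h.map ψ⟩

theorem IsLocallyRich.disjoint_closedSupport_map_iff (hG : IsLocallyRich G X)
    (hH : IsLocallyRich H Y) (ψ : G ≃* H) {f g : G} :
    Disjoint (closedSupport Y (ψ f)) (closedSupport Y (ψ g)) ↔
      Disjoint (closedSupport X f) (closedSupport X g) := by
  rw [hG.disjoint_closedSupport_iff, hH.disjoint_closedSupport_iff, ψ.surjective.forall]
  refine forall_congr' fun k => ?_
  rw [hG.closedSupport_map_subset_iff hH, hG.closedSupport_map_subset_iff hH,
    map_eq_one_iff _ ψ.injective]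

/-- The supports containing `x` are directed downwards, and so are their images under `ψ`;
compactness gives a common point `y`. A further support through `y` would be disjoint from one of
these. -/
theorem IsLocallyRich.exists_forall_mem_closedSupport_iff (hG : IsLocallyRich G X)
    (hH : IsLocallyRich H Y) (ψ : G ≃* H) (x : X) :
    ∃ y : Y, ∀ g, y ∈ closedSupport Y (ψ g) ↔ x ∈ closedSupport X g := by
  let S := {g : G // x ∈ closedSupport X g}
  have hne : Nonempty S := by
    obtain ⟨g, hg, -⟩ := hG.exists_mem_closedSupport_subset (x := x) Filter.univ_mem
    exact ⟨⟨g, hg⟩⟩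
  have hI : (⋂ g : S, closedSupport Y (ψ g.1)).Nonempty := by
    refine IsCompact.nonempty_iInter_of_directed_nonempty_isCompact_isClosed _ ?_ ?_
      (fun g => isClosed_closure.isCompact) fun g => isClosed_closure
    · rintro ⟨f, hf⟩ ⟨g, hg⟩
      obtain ⟨k, hxk, hk⟩ := hG.exists_mem_closedSupport_subset
        (((hG.isOpen_closedSupport f).inter (hG.isOpen_closedSupport g)).mem_nhds ⟨hf, hg⟩)
      exact ⟨⟨k, hxk⟩, (hG.closedSupport_map_subset_iff hH ψ).2 fun y hy => (hk hy).1,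
        (hG.closedSupport_map_subset_iff hH ψ).2 fun y hy => (hk hy).2⟩
    · rintro ⟨g, hg⟩
      rw [Set.nonempty_iff_ne_empty]
      intro e
      have h1 : ψ g = 1 := eq_of_smul_eq_smul (α := Y) fun y => by
        rw [one_smul]
        exact smul_eq_of_notMem_closedSupport fun hy => by rw [e] at hy; exact hy
      rw [map_eq_one_iff _ ψ.injective] at h1
      subst h1
      simp [closedSupport] at hg
  obtain ⟨y, hy⟩ := hI
  rw [Set.mem_iInter] at hy
  refine ⟨y, fun g => ⟨fun h => ?_, fun h => hy ⟨g, h⟩⟩⟩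
  by_contra hx
  obtain ⟨f, hxf, hf⟩ := hG.exists_mem_closedSupport_subset
    (isClosed_closure.isOpen_compl (s := closedSupport X g) |>.mem_nhds hx)
  have hd : Disjoint (closedSupport X f) (closedSupport X g) :=
    (disjoint_compl_left).mono_left hf
  exact ((hG.disjoint_closedSupport_map_iff hH ψ).2 hd).le_bot ⟨hy ⟨f, hxf⟩, h⟩

/-- Reconstruction: an isomorphism between locally rich groups is spatial. -/
theorem IsLocallyRich.exists_homeomorph (hG : IsLocallyRich G X)
    (hH : IsLocallyRich H Y) (ψ : G ≃* H) :
    ∃ h : X ≃ₜ Y, ∀ g x, h (g • x) = ψ g • h x := by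
  choose p hp using hG.exists_forall_mem_closedSupport_iff hH ψ
  choose q hq using hH.exists_forall_mem_closedSupport_iff hG ψ.symm
  have hqp : ∀ x, q (p x) = x := fun x => Eq.symm <|
    hG.eq_of_forall_mem_closedSupport fun g hg => by
      have := (hq (p x) (ψ g)).2 ((hp x g).2 hg)
      simpa using this
  have hpq : ∀ y, p (q y) = y := fun y => Eq.symm <|
    hH.eq_of_forall_mem_closedSupport fun g hg => by
      have := (hp (q y) (ψ.symm g)).2 ((hq y g).2 hg)
      simpa using this
  -- Small supports are neighbourhoods, and `p` pulls the support of `ψ g` back to the open support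
  -- of `g`.
  have hcp : Continuous p := by
    rw [continuous_iff_continuousAt]
    intro x A hA
    obtain ⟨g, hg, hgA⟩ := hH.exists_mem_closedSupport_subset hA
    obtain ⟨g, rfl⟩ := ψ.surjective g
    rw [hp] at hg
    rw [Filter.mem_map]
    filter_upwards [(hG.isOpen_closedSupport g).mem_nhds hg] with z hz
    exact hgA ((hp z g).2 hz)
  let e : X ≃ Y := ⟨p, q, hqp, hpq⟩
  let h : X ≃ₜ Y := hcp.homeoOfEquivCompactToT2 (f := e)
  refine ⟨h, fun g x => ?_⟩
  change p (g • x) = ψ g • p x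
  -- Translating a point corresponds to conjugating the elements whose supports contain it, and `ψ`
  -- respects conjugation.
  refine hH.eq_of_forall_mem_closedSupport fun f hf => ?_
  obtain ⟨f, rfl⟩ := ψ.surjective f
  rw [hp, smul_mem_closedSupport_iff] at hf
  rw [smul_mem_closedSupport_iff, ← map_inv, ← map_mul, ← map_mul, hp]
  exact hf

end TwoActions

end Reconstruction

/-! ### Full actions: small cycles in the commutator subgroup, and extension of automorphisms -/

section FullActions

open scoped commutatorElement

/-- A full action on a space: closed supports are open, every homeomorphism that locally agrees
with group elements is a group element, and no point is isolated in its orbit. -/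
structure IsFullAction (F X : Type*) [Group F] [TopologicalSpace X] [MulAction F X] : Prop where
  isOpen_closedSupport : ∀ f : F, IsOpen (closedSupport X f)
  exists_of_locally : ∀ h : X ≃ₜ X, (∀ x, ∃ f : F, ∀ᶠ y in 𝓝 x, h y = f • y) →
    ∃ f : F, ∀ x, f • x = h x
  exists_smul_mem_ne : ∀ x : X, ∀ A ∈ 𝓝 x, ∃ f : F, f • x ∈ A ∧ f • x ≠ x

namespace IsFullAction

variable {F X : Type*} [Group F] [TopologicalSpace X] [MulAction F X]
  [CompactSpace X] [T2Space X] [TotallyDisconnectedSpace X]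
  [ContinuousConstSMul F X] [FaithfulSMul F X]

/-- The involution that exchanges a clopen set with a disjoint translate. -/
theorem exists_swap (hF : IsFullAction F X) (f : F) {B : Set X} (hB : IsClopen B)
    (hd : ∀ y ∈ B, f • y ∉ B) :
    ∃ t : F, (∀ y ∈ B, t • y = f • y) ∧ (∀ y ∈ B, t • f • y = y) ∧
      ∀ y ∉ B, f⁻¹ • y ∉ B → t • y = y := by
  classical
  let s : X → X := fun y => if y ∈ B then f • y else if f⁻¹ • y ∈ B then f⁻¹ • y else y
  have s₁ : ∀ y ∈ B, s y = f • y := fun y hy => if_pos hy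
  have s₂ : ∀ y, f⁻¹ • y ∈ B → s y = f⁻¹ • y := fun y hy => by
    have hyB : y ∉ B := fun h => by simpa [h] using hd _ hy
    simp [s, hyB, hy]
  have s₃ : ∀ y ∉ B, f⁻¹ • y ∉ B → s y = y := fun y h h' => by simp [s, h, h']
  have hs : Function.Involutive s := by
    intro y
    by_cases h : y ∈ B
    · rw [s₁ y h, s₂ _ (by simpa using h), inv_smul_smul]
    by_cases h' : f⁻¹ • y ∈ B
    · rw [s₂ y h', s₁ _ h', smul_inv_smul]
    · rw [s₃ y h h', s₃ y h h']
  have hB' : IsClopen ((f⁻¹ • ·) ⁻¹' B : Set X) := hB.preimage (continuous_const_smul f⁻¹)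
  have hloc : ∀ x, ∃ g : F, ∀ᶠ y in 𝓝 x, s y = g • y := by
    intro x
    by_cases h : x ∈ B
    · exact ⟨f, Filter.mem_of_superset (hB.isOpen.mem_nhds h) s₁⟩
    by_cases h' : f⁻¹ • x ∈ B
    · exact ⟨f⁻¹, Filter.mem_of_superset (hB'.isOpen.mem_nhds h') s₂⟩
    · refine ⟨1, ?_⟩
      filter_upwards [hB.compl.isOpen.mem_nhds h, hB'.compl.isOpen.mem_nhds h'] with y hy hy'
      rw [s₃ y hy hy', one_smul]
  have hc : Continuous s := by
    rw [continuous_iff_continuousAt]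
    intro x
    obtain ⟨g, hg⟩ := hloc x
    exact (continuous_const_smul g).continuousAt.congr (hg.mono fun y hy => hy.symm)
  obtain ⟨t, ht⟩ := hF.exists_of_locally ⟨hs.toPerm, hc, hc⟩ hloc
  replace ht : ∀ x, t • x = s x := ht
  refine ⟨t, fun y hy => by rw [ht, s₁ y hy], fun y hy => ?_, fun y h h' => by rw [ht, s₃ y h h']⟩
  rw [ht, s₂ _ (by simpa using hy), inv_smul_smul]

/-- Swaps of the sets in a family of disjoint translates of a clopen set with the set itself. -/
theorem exists_swaps (hF : IsFullAction F X) {n : ℕ} (f : Fin (n + 1) → F) (hf0 : f 0 = 1) {x : X}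
    (hf : Function.Injective fun i => f i • x) {A : Set X} (hA : ∀ i, A ∈ 𝓝 (f i • x)) :
    ∃ B ∈ 𝓝 x, ∃ t : Fin (n + 1) → F, (∀ i, ∀ y ∈ B, f i • y ∈ A) ∧
      (∀ i ≠ 0, t i * t i = 1) ∧ (∀ i ≠ 0, ∀ y ∈ B, t i • y = f i • y) ∧
      (∀ i ≠ 0, ∀ y ∈ B, t i • f i • y = y) ∧
      (∀ i ≠ 0, ∀ j ≠ 0, j ≠ i → ∀ y ∈ B, t i • f j • y = f j • y) ∧
      ∀ i ≠ 0, ∀ y, (∀ j, ∀ z ∈ B, y ≠ f j • z) → t i • y = y := by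
  obtain ⟨U, hU, hxU, hdis⟩ := exists_isOpen_forall_smul_ne f hf
  have hN : U ∩ ⋂ i, (f i • ·) ⁻¹' interior A ∈ 𝓝 x :=
    Filter.inter_mem (hU.mem_nhds hxU) <| (isOpen_iInter_of_finite fun i =>
      isOpen_interior.preimage (continuous_const_smul (f i))).mem_nhds <|
        Set.mem_iInter.2 fun i => mem_interior_iff_mem_nhds.2 (hA i)
  obtain ⟨N, hNU, hNo, hxN⟩ := mem_nhds_iff.1 hN
  obtain ⟨B, hB, hxB, hBN⟩ := compact_exists_isClopen_in_isOpen hNo hxN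
  have hBU : ∀ y ∈ B, y ∈ U := fun y hy => (hNU (hBN hy)).1
  have hd : ∀ i ≠ 0, ∀ y ∈ B, f i • y ∉ B := fun i hi y hy hc => by
    refine hdis i 0 hi y (hBU y hy) (f i • y) (hBU _ hc) ?_
    rw [hf0, one_smul]
  have hst : ∀ i, ∃ t : F, i ≠ 0 → (∀ y ∈ B, t • y = f i • y) ∧ (∀ y ∈ B, t • f i • y = y) ∧
      ∀ y ∉ B, (f i)⁻¹ • y ∉ B → t • y = y := fun i => by
    by_cases hi : i = 0
    · exact ⟨1, fun h => absurd hi h⟩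
    · obtain ⟨t, ht⟩ := hF.exists_swap (f i) hB (hd i hi)
      exact ⟨t, fun _ => ht⟩
  choose t ht using hst
  refine ⟨B, hB.isOpen.mem_nhds hxB, t, fun i y hy =>
    interior_subset (Set.mem_iInter.1 (hNU (hBN hy)).2 i), fun i hi => ?_,
    fun i hi => (ht i hi).1, fun i hi => (ht i hi).2.1, fun i hi j hj hij y hy => ?_,
    fun i hi y hy => ?_⟩
  · refine eq_of_smul_eq_smul (α := X) fun y => ?_
    rw [mul_smul, one_smul]
    by_cases h : y ∈ B
    · rw [(ht i hi).1 y h, (ht i hi).2.1 y h]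
    by_cases h' : (f i)⁻¹ • y ∈ B
    · have e : y = f i • (f i)⁻¹ • y := (smul_inv_smul _ _).symm
      have := (ht i hi).2.1 _ h'
      rw [smul_inv_smul] at this
      rw [this, (ht i hi).1 _ h', smul_inv_smul]
    · rw [(ht i hi).2.2 y h h', (ht i hi).2.2 y h h']
  · refine (ht i hi).2.2 _ (hd j hj y hy) fun hc => ?_
    refine hdis i j hij.symm _ (hBU _ hc) y (hBU y hy) ?_
    rw [smul_inv_smul]
  · refine (ht i hi).2.2 y (fun hc => hy 0 y hc ?_) fun hc => hy i _ hc ?_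
    · rw [hf0, one_smul]
    · rw [smul_inv_smul]

theorem exists_smul_mem_notMem (hF : IsFullAction F X) (x : X) {A : Set X} (hA : A ∈ 𝓝 x)
    {S : Set X} (hS : S.Finite) : ∃ f : F, f • x ∈ A ∧ f • x ∉ S ∧ f • x ≠ x := by
  obtain ⟨f, h, h'⟩ := hF.exists_smul_mem_ne x (A ∩ (S \ {x})ᶜ) (Filter.inter_mem hA
    (hS.sdiff.isClosed.isOpen_compl.mem_nhds fun hc => hc.2 rfl))
  exact ⟨f, h.1, fun hc => h.2 ⟨hc, h'⟩, h'⟩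

/-- With `t i` acting as the transposition `(0 i)` on five disjoint translates of a small set, `⁅t
1, t 2⁆` and `⁅t 3, t 4⁆` are 3-cycles sharing only `0`, so their product is a 5-cycle. -/
theorem exists_pow_five (hF : IsFullAction F X) (x : X) {A : Set X} (hA : A ∈ 𝓝 x) :
    ∃ g ∈ commutator F, g ^ 5 = 1 ∧ g • x ≠ x ∧ ∀ y ∉ A, g • y = y := by
  obtain ⟨O, hOA, hO, hxO⟩ := mem_nhds_iff.1 hA
  have hO' := hO.mem_nhds hxO
  obtain ⟨f₁, m₁, -, n₁⟩ := hF.exists_smul_mem_notMem x hO' (Set.finite_empty)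
  obtain ⟨f₂, m₂, d₂, n₂⟩ := hF.exists_smul_mem_notMem x hO' (Set.toFinite {f₁ • x})
  obtain ⟨f₃, m₃, d₃, n₃⟩ := hF.exists_smul_mem_notMem x hO' (Set.toFinite {f₁ • x, f₂ • x})
  obtain ⟨f₄, m₄, d₄, n₄⟩ :=
    hF.exists_smul_mem_notMem x hO' (Set.toFinite {f₁ • x, f₂ • x, f₃ • x})
  simp only [Set.mem_insert_iff, Set.mem_singleton_iff, not_or] at d₂ d₃ d₄
  let f : Fin 5 → F := ![1, f₁, f₂, f₃, f₄]
  have hinj : Function.Injective fun i => f i • x := by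
    have key : ∀ i j : Fin 5, i < j → f j • x ≠ f i • x := by
      intro i j hij
      fin_cases i <;> fin_cases j <;> first | exact absurd hij (by decide) | simp [f, *]
    intro i j e
    rcases lt_trichotomy i j with h | h | h
    · exact absurd e.symm (key i j h)
    · exact h
    · exact absurd e (key j i h)
  have hmem : ∀ i, f i • x ∈ O := by
    intro i
    fin_cases i <;> simp [f, *]
  obtain ⟨B, hB, t, hBA, htt, h0, h1, h2, h3⟩ := hF.exists_swaps f rfl hinj
    fun i => Filter.mem_of_superset (hO.mem_nhds (hmem i)) hOA
  have hinv : ∀ i ≠ 0, (t i)⁻¹ = t i := fun i hi => inv_eq_of_mul_eq_one_left (htt i hi)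
  have e : ∀ i ≠ 0, ∀ j ≠ 0, ⁅t i, t j⁆ = t i * (t j * (t i * t j)) := fun i hi j hj => by
    rw [commutatorElement_def, hinv i hi, hinv j hj]
    simp only [mul_assoc]
  have hf0 : f 0 = 1 := rfl
  have hg : ∀ i : Fin 5, ∀ y ∈ B,
      -- The vector encodes the cycle `0 → 3 → 4 → 1 → 2 → 0`.
      (⁅t 1, t 2⁆ * ⁅t 3, t 4⁆) • f i • y = f (![3, 2, 0, 4, 1] i) • y := by
    intro i y hy
    rw [e 1 (by decide) 2 (by decide), e 3 (by decide) 4 (by decide)]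
    simp only [mul_smul]
    fin_cases i <;> simp [h0, h1, h2, hy, hf0]
  set g := ⁅t 1, t 2⁆ * ⁅t 3, t 4⁆ with hgdef
  have hgO : ∀ y, (∀ j, ∀ z ∈ B, y ≠ f j • z) → g • y = y := by
    intro y hy
    rw [hgdef, e 1 (by decide) 2 (by decide), e 3 (by decide) 4 (by decide)]
    simp only [mul_smul]
    have k := fun (i : Fin 5) (hi : i ≠ 0) => h3 i hi y hy
    simp [k]
  have hxB := mem_of_mem_nhds hB
  refine ⟨g, Subgroup.mul_mem _ ?_ ?_, ?_, ?_, ?_⟩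
  · exact Subgroup.commutator_mem_commutator (Subgroup.mem_top _) (Subgroup.mem_top _)
  · exact Subgroup.commutator_mem_commutator (Subgroup.mem_top _) (Subgroup.mem_top _)
  · refine eq_of_smul_eq_smul (α := X) fun y => ?_
    rw [one_smul]
    by_cases hy : ∀ j, ∀ z ∈ B, y ≠ f j • z
    · simp [pow_succ, mul_smul, hgO y hy]
    · push Not at hy
      obtain ⟨j, z, hz, rfl⟩ := hy
      simp only [pow_succ, pow_zero, one_mul, mul_smul, hg _ z hz]
      fin_cases j <;> rfl
  · have := hg 0 x hxB
    rw [hf0, one_smul] at this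
    rw [this]
    exact n₃
  · exact fun y hy => hgO y fun j z hz hc => hy (hc ▸ hBA j z hz)

theorem isLocallyRich_commutator (hF : IsFullAction F X) : IsLocallyRich (commutator F) X where
  isOpen_closedSupport g := hF.isOpen_closedSupport g.1
  exists_pow_five x A hA := by
    obtain ⟨g, hg, h5, hx, hA⟩ := hF.exists_pow_five x hA
    exact ⟨⟨g, hg⟩, Subtype.ext h5, hx, hA⟩

/-- A third orbit point `g • x` turns the swap of `x` and `f • x` into a 3-cycle, which is a
commutator and still acts as `f` near `x`. -/
theorem exists_commutator_eventuallyEq_of_ne (hF : IsFullAction F X) {f : F} {x : X}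
    (hx : f • x ≠ x) : ∃ d ∈ commutator F, ∀ᶠ y in 𝓝 x, d • y = f • y := by
  obtain ⟨g, -, hg, hg'⟩ := hF.exists_smul_mem_notMem x Filter.univ_mem (Set.toFinite {f • x})
  let u : Fin 3 → F := ![1, f, g]
  have hinj : Function.Injective fun i => u i • x := by
    have key : ∀ i j : Fin 3, i < j → u j • x ≠ u i • x := by
      intro i j hij
      simp only [Set.mem_singleton_iff] at hg
      fin_cases i <;> fin_cases j <;> first | exact absurd hij (by decide) | simp [u, *]
    intro i j e
    rcases lt_trichotomy i j with h | h | h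
    · exact absurd e.symm (key i j h)
    · exact h
    · exact absurd e (key j i h)
  obtain ⟨B, hB, t, -, htt, h0, h1, h2, -⟩ := hF.exists_swaps u rfl hinj
    fun i => Filter.univ_mem
  have hinv : ∀ i ≠ 0, (t i)⁻¹ = t i := fun i hi => inv_eq_of_mul_eq_one_left (htt i hi)
  refine ⟨⁅t 1, t 2⁆,
    Subgroup.commutator_mem_commutator (Subgroup.mem_top _) (Subgroup.mem_top _), ?_⟩
  filter_upwards [hB] with y hy
  rw [commutatorElement_def, hinv 1 (by decide), hinv 2 (by decide)]
  simp only [mul_smul]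
  rw [h0 2 (by decide) y hy, h2 1 (by decide) 2 (by decide) (by decide) y hy,
    h1 2 (by decide) y hy, h0 1 (by decide) y hy]
  rfl

theorem exists_commutator_eventuallyEq (hF : IsFullAction F X) (f : F) (x : X) :
    ∃ d ∈ commutator F, ∀ᶠ y in 𝓝 x, d • y = f • y := by
  by_cases hx : f • x = x
  -- When `f` fixes `x`, write `f = (f g⁻¹) g` with `g` in the commutator subgroup moving `x`; then
  -- `f g⁻¹` moves `g • x`.
  · obtain ⟨g, hg, -, hgx, -⟩ := hF.exists_pow_five x Filter.univ_mem
    have : (f * g⁻¹) • g • x ≠ g • x := by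
      rw [mul_smul, inv_smul_smul, hx]
      exact hgx.symm
    obtain ⟨d, hd, hdf⟩ := hF.exists_commutator_eventuallyEq_of_ne this
    refine ⟨d * g, mul_mem hd hg, ?_⟩
    have := (continuous_const_smul g).continuousAt.eventually hdf
    filter_upwards [this] with y hy
    rw [mul_smul, hy, mul_smul, inv_smul_smul]
  · exact hF.exists_commutator_eventuallyEq_of_ne hx

theorem eq_one_of_commute_commutator (hF : IsFullAction F X) {u : F}
    (hu : ∀ d ∈ commutator F, Commute u d) : u = 1 := by
  refine eq_of_smul_eq_smul (α := X) fun x => ?_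
  rw [one_smul]
  by_contra hx
  obtain ⟨g, hg, -, hgx, hgA⟩ := hF.exists_pow_five x (A := {u • x}ᶜ)
    (isOpen_compl_singleton.mem_nhds (Ne.symm hx))
  have := congrArg (· • x) (hu g hg).eq
  simp only [mul_smul] at this
  rw [hgA (u • x) (by simp)] at this
  exact hgx (smul_left_cancel _ this)

/-- If `f` agrees with `d` near a point, then `h f h⁻¹` agrees with `ψ d` near its image, so
fullness puts `h f h⁻¹` in `F`. -/
theorem exists_monoidHom_of_homeomorph (hF : IsFullAction F X)
    (ψ : commutator F ≃* commutator F) (h : X ≃ₜ X) (hh : ∀ (d : commutator F) x,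
      h (d • x) = ψ d • h x) : ∃ Φ : F →* F, ∀ f x, Φ f • h x = h (f • x) := by
  have key : ∀ f : F, ∃ f' : F, ∀ x, f' • x = h (f • h.symm x) := by
    intro f
    refine hF.exists_of_locally ((h.symm.trans (Homeomorph.smul f)).trans h) fun x => ?_
    obtain ⟨d, hd, hdf⟩ := hF.exists_commutator_eventuallyEq f (h.symm x)
    refine ⟨ψ ⟨d, hd⟩, ?_⟩
    filter_upwards [h.symm.continuous.continuousAt.eventually hdf] with y hy
    change h (f • h.symm y) = (ψ ⟨d, hd⟩ : F) • y
    rw [← hy]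
    have := hh ⟨d, hd⟩ (h.symm y)
    rw [h.apply_symm_apply] at this
    exact this
  choose Φ hΦ using key
  refine ⟨MonoidHom.mk' Φ fun f g => eq_of_smul_eq_smul (α := X) fun x => ?_, fun f x => ?_⟩
  · simp [hΦ, mul_smul]
  · simp [hΦ]

theorem exists_extension (hF : IsFullAction F X) (ψ : commutator F ≃* commutator F) :
    ∃ Φ : F ≃* F, ∀ d : commutator F, Φ d = ψ d := by
  have hD := hF.isLocallyRich_commutator
  have : ContinuousConstSMul (commutator F) X := ⟨fun d => continuous_const_smul (d : F)⟩
  obtain ⟨h, hh⟩ := hD.exists_homeomorph hD ψ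
  obtain ⟨Φ, hΦ⟩ := hF.exists_monoidHom_of_homeomorph ψ h hh
  obtain ⟨Θ, hΘ⟩ := hF.exists_monoidHom_of_homeomorph ψ.symm h.symm fun d x => by
    rw [h.symm_apply_eq, hh, ψ.apply_symm_apply, h.apply_symm_apply]
  refine ⟨MonoidHom.toMulEquiv Φ Θ ?_ ?_, fun d => ?_⟩
  · ext f
    refine eq_of_smul_eq_smul (α := X) fun x => ?_
    have := hΘ (Φ f) (h x)
    rw [hΦ] at this
    simpa using this
  · ext f
    refine eq_of_smul_eq_smul (α := X) fun x => ?_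
    have := hΦ (Θ f) (h.symm x)
    rw [hΘ] at this
    simpa using this
  · refine eq_of_smul_eq_smul (α := X) fun x => ?_
    obtain ⟨x, rfl⟩ := h.surjective x
    change Φ d • h x = _
    rw [hΦ]
    exact hh d x

end IsFullAction

end FullActions

/-! ### Formal consequences for outer automorphism groups -/

section OuterAutomorphisms

open AmpleGroupoid

variable {F : Type*} [Group F]

/-- If `φ` fixes `D` pointwise, comparing `φ (f d f⁻¹)` with `f d f⁻¹` shows that `f⁻¹ * φ f`
centralizes `D`. -/
theorem characteristic_commutator_injective
    (hc : ∀ u : F, (∀ d ∈ commutator F, Commute u d) → u = 1) :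
    Function.Injective (MulAut.characteristic (commutator F) :
      MulAut F →* MulAut (commutator F)) := by
  rw [injective_iff_map_eq_one]
  intro φ hφ
  have hφd : ∀ d ∈ commutator F, φ d = d := fun d hd => by
    have h := DFunLike.congr_fun hφ (⟨d, hd⟩ : commutator F)
    exact congrArg Subtype.val h
  ext f
  have := hc (f⁻¹ * φ f) fun d hd => by
    have h₁ : f * d * f⁻¹ ∈ commutator F := Subgroup.Normal.conj_mem inferInstance d hd f
    have h₂ := hφd _ h₁
    rw [map_mul, map_mul, map_inv, hφd d hd] at h₂
    have h₃ : φ f * d = f * d * f⁻¹ * φ f := by rw [← h₂]; group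
    change f⁻¹ * φ f * d = d * (f⁻¹ * φ f)
    rw [mul_assoc, h₃]
    group
  exact (inv_mul_eq_one.1 this).symm

theorem conjOut_injective (hc : ∀ u : F, (∀ d ∈ commutator F, Commute u d) → u = 1) :
    Function.Injective (conjOut F) := by
  rw [injective_iff_map_eq_one]
  intro q hq
  obtain ⟨u, rfl⟩ := QuotientGroup.mk_surjective q
  have hu : MulAut.conjNormal u ∈ innerAut (commutator F) := (QuotientGroup.eq_one_iff _).1 hq
  obtain ⟨d, hd⟩ := hu
  have := hc ((d : F)⁻¹ * u) fun e he => by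
    have h := congrArg Subtype.val (DFunLike.congr_fun hd ⟨e, he⟩)
    simp only [MulAut.conj_apply, MulAut.conjNormal_apply, Subgroup.coe_mul, Subgroup.coe_inv] at h
    have h' : u * e = d * e * (d : F)⁻¹ * u := by rw [h]; group
    change (d : F)⁻¹ * u * e = e * ((d : F)⁻¹ * u)
    rw [mul_assoc, h']
    group
  rw [QuotientGroup.eq_one_iff, ← inv_mul_eq_one.1 this]
  exact d.2

theorem exists_exact_of_bijective_characteristic
    (hb : Function.Bijective (MulAut.characteristic (commutator F) :
      MulAut F →* MulAut (commutator F))) :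
    ∃ π : OuterAut (commutator F) →* OuterAut F,
      (∀ φ : MulAut F, π (QuotientGroup.mk (MulAut.characteristic (commutator F) φ)) =
        QuotientGroup.mk φ) ∧
      Function.MulExact (conjOut F) π ∧ Function.Surjective π := by
  let e := MulEquiv.ofBijective _ hb
  have he : ∀ u : F, e (MulAut.conj u) = MulAut.conjNormal u := fun u => by
    ext d
    rfl
  have hle : innerAut (commutator F) ≤ (innerAut F).comap e.symm.toMonoidHom := by
    rintro _ ⟨d, rfl⟩
    refine ⟨d, ?_⟩
    rw [MulEquiv.coe_toMonoidHom, MulEquiv.eq_symm_apply, he]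
    ext d'
    simp
  let π := QuotientGroup.map _ _ e.symm.toMonoidHom hle
  have hπ : ∀ φ : MulAut F,
      π (QuotientGroup.mk (MulAut.characteristic (commutator F) φ)) = QuotientGroup.mk φ :=
    fun φ => congrArg QuotientGroup.mk (e.symm_apply_apply φ)
  refine ⟨π, hπ, fun q => ?_, fun q => ?_⟩
  · obtain ⟨ψ, rfl⟩ := QuotientGroup.mk_surjective q
    obtain ⟨φ, rfl⟩ := hb.surjective ψ
    rw [hπ, QuotientGroup.eq_one_iff]
    constructor
    · rintro ⟨u, rfl⟩
      exact ⟨QuotientGroup.mk u, congrArg QuotientGroup.mk (he u).symm⟩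
    · rintro ⟨q, hq⟩
      obtain ⟨u, rfl⟩ := QuotientGroup.mk_surjective q
      have h : (QuotientGroup.mk (e (MulAut.conj u)) : OuterAut (commutator F)) =
          QuotientGroup.mk (e φ) := by
        rw [he]
        exact hq
      have h' := congrArg π h
      have h₁ := hπ (MulAut.conj u)
      have h₂ := hπ φ
      rw [← QuotientGroup.eq_one_iff]
      exact (h₂.symm.trans h'.symm).trans (h₁.trans ((QuotientGroup.eq_one_iff _).2 ⟨u, rfl⟩))
  · obtain ⟨φ, rfl⟩ := QuotientGroup.mk_surjective q
    exact ⟨_, hπ φ⟩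

end OuterAutomorphisms

/-! ### The topological full group acts fully on the unit space -/

namespace AmpleGroupoid

section Sections

variable {X : Type*} [Groupoid X] [TopologicalSpace X] [TopologicalSpace (Arr X)]

/-- The arrow with source `x` in a global bisection. -/
noncomputable def FullGroup.arrow (U : FullGroup X) : X → Arr X :=
  U.isGlobalBisection.exists_section.choose

namespace FullGroup

theorem continuous_arrow (U : FullGroup X) : Continuous U.arrow :=
  U.isGlobalBisection.exists_section.choose_spec.choose_spec.1

theorem range_arrow (U : FullGroup X) : Set.range U.arrow = U.carrier :=
  U.isGlobalBisection.exists_section.choose_spec.choose_spec.2.1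

@[simp] theorem arrow_left (U : FullGroup X) (x : X) : (U.arrow x).left = x :=
  U.isGlobalBisection.exists_section.choose_spec.choose_spec.2.2.1 x

theorem continuous_arrow_right (U : FullGroup X) : Continuous fun x => (U.arrow x).right := by
  obtain ⟨φ, h⟩ := U.isGlobalBisection.exists_section.choose_spec
  exact φ.continuous.congr fun x => (h.2.2.2 x).symm

theorem arrow_mem (U : FullGroup X) (x : X) : U.arrow x ∈ U.carrier :=
  U.range_arrow ▸ Set.mem_range_self x

theorem eq_arrow {U : FullGroup X} {g : Arr X} (hg : g ∈ U.carrier) {x : X} (hx : g.left = x) :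
    U.arrow x = g := by
  rw [← U.range_arrow] at hg
  obtain ⟨y, rfl⟩ := hg
  rw [arrow_left] at hx
  rw [hx]

variable [IsEtaleGroupoid X] [T2Space (Arr X)]

theorem arrow_one (x : X) : (1 : FullGroup X).arrow x = unit x :=
  eq_arrow (U := 1) (Set.mem_range_self x) rfl

theorem arrow_mul (U V : FullGroup X) (x : X) :
    (U * V).arrow x = mul (U.arrow (V.arrow x).right) (V.arrow x) (U.arrow_left _) :=
  eq_arrow (U := U * V) ⟨_, U.arrow_mem _, _, V.arrow_mem _, _, rfl⟩ (V.arrow_left x)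

/-- The action of the topological full group on the unit space. -/
noncomputable instance : MulAction (FullGroup X) X where
  smul U x := (U.arrow x).right
  one_smul x := congrArg Quiver.Total.right (arrow_one x)
  mul_smul U V x := by
    change ((U * V).arrow x).right = (U.arrow (V.arrow x).right).right
    rw [arrow_mul, mul_right]

theorem smul_eq (U : FullGroup X) (x : X) : U • x = (U.arrow x).right := rfl

instance : ContinuousConstSMul (FullGroup X) X := ⟨fun U => U.continuous_arrow_right⟩

theorem isClopen_range_of_section {σ : X → Arr X} (hσ : Continuous σ)
    (hl : ∀ x, (σ x).left = x) : IsClopen (Set.range σ) := by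
  have hs := IsTopologicalGroupoid.continuous_source (X := X)
  constructor
  · have e : Set.range σ = {g | σ g.left = g} := by
      ext g
      constructor
      · rintro ⟨x, rfl⟩
        exact congrArg σ (hl x)
      · intro hg
        exact ⟨_, hg⟩
    rw [e]
    exact isClosed_eq (hσ.comp hs) continuous_id
  · rw [isOpen_iff_mem_nhds]
    rintro _ ⟨x, rfl⟩
    obtain ⟨W, hxW, hW⟩ := IsEtaleGroupoid.isLocalHomeomorph_source (X := X) (σ x)
    have h1 : W.source ∈ 𝓝 (σ x) := W.open_source.mem_nhds hxW
    have h2 : (fun g : Arr X => σ g.left) ⁻¹' W.source ∈ 𝓝 (σ x) := by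
      refine (hσ.comp hs).continuousAt.preimage_mem_nhds ?_
      simpa [hl] using h1
    filter_upwards [h1, h2] with g hg hg'
    refine ⟨g.left, W.injOn hg' hg ?_⟩
    rw [← hW]
    exact hl _

theorem exists_arrow_eq_section {σ : X → Arr X} (hσ : Continuous σ) (hl : ∀ x, (σ x).left = x)
    (h : X ≃ₜ X) (hr : ∀ x, (σ x).right = h x) : ∃ U : FullGroup X, ∀ x, U.arrow x = σ x :=
  ⟨⟨Set.range σ, IsGlobalBisection.of_section (isClopen_range_of_section hσ hl) σ h hσ rfl hl hr⟩,
    fun x => eq_arrow (Set.mem_range_self x) (hl x)⟩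

/-- If `U` fixes an open set pointwise, its arrows over that set form an open set of isotropy, hence
units by effectiveness. The right-hand side is clopen, which is how supports become open. -/
theorem closedSupport_eq (heff : IsEffective X) (U : FullGroup X) :
    closedSupport X U = (U.arrow ⁻¹' Set.range unit)ᶜ := by
  have hu := isGlobalBisection_unit X
  apply Set.Subset.antisymm
  · refine closedSupport_subset (hu.isClopen.preimage U.continuous_arrow).compl.isClosed
      fun y hy => ?_
    obtain ⟨z, hz⟩ := not_not.1 hy
    obtain rfl : z = y := by simpa using congrArg Quiver.Total.left hz
    rw [smul_eq, ← hz]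
    rfl
  · intro x hx
    refine mem_closure_iff.2 fun O hO hxO => ?_
    by_contra hc
    apply hx
    have hopen : IsOpen (U.carrier ∩ (fun g : Arr X => g.left) ⁻¹' O) :=
      U.isGlobalBisection.isClopen.isOpen.inter
        (hO.preimage IsTopologicalGroupoid.continuous_source)
    rw [Set.mem_preimage, ← heff]
    refine mem_interior.2 ⟨_, fun g hg => ?_, hopen, U.arrow_mem x, ?_⟩
    · by_contra hne
      refine hc ⟨g.left, hg.2, fun e => hne ?_⟩
      rw [smul_eq, eq_arrow hg.1 rfl] at e
      exact e.symm
    · simpa using hxO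

theorem arrow_eq_of_eventuallyEq (heff : IsEffective X) {U V : FullGroup X} {x : X}
    (h : ∀ᶠ y in 𝓝 x, U • y = V • y) : U.arrow x = V.arrow x := by
  have hk : x ∉ closedSupport X (V⁻¹ * U) := by
    intro hx
    obtain ⟨O, hO, hOo, hxO⟩ := mem_nhds_iff.1 h
    obtain ⟨y, hy, hne⟩ := mem_closure_iff.1 hx O hOo hxO
    apply hne
    rw [mul_smul, inv_smul_eq_iff]
    exact hO hy
  rw [closedSupport_eq heff, Set.notMem_compl_iff] at hk
  obtain ⟨z, hz⟩ := hk
  obtain rfl : z = x := by simpa using congrArg Quiver.Total.left hz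
  have hm : V.arrow z ∈ (V * (V⁻¹ * U)).carrier :=
    ⟨V.arrow z, V.arrow_mem z, unit z, hz ▸ arrow_mem _ z, V.arrow_left z,
      (arr_mul_unit _ _ _).symm⟩
  rw [mul_inv_cancel_left] at hm
  exact eq_arrow hm (V.arrow_left z)

theorem faithfulSMul (heff : IsEffective X) : FaithfulSMul (FullGroup X) X where
  eq_of_smul_eq_smul {U V} h := by
    apply FullGroup.ext
    rw [← U.range_arrow, ← V.range_arrow]
    exact congrArg Set.range <| funext fun x =>
      arrow_eq_of_eventuallyEq heff (Filter.Eventually.of_forall h)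

theorem exists_of_locally (heff : IsEffective X) (h : X ≃ₜ X)
    (hloc : ∀ x, ∃ U : FullGroup X, ∀ᶠ y in 𝓝 x, h y = U • y) :
    ∃ U : FullGroup X, ∀ x, U • x = h x := by
  choose U hU using hloc
  -- Germs determine arrows, so near `x` the glued section coincides with the arrows of the single
  -- bisection `U x`.
  have hσ : Continuous fun x => (U x).arrow x := by
    rw [continuous_iff_continuousAt]
    intro x
    refine (U x).continuous_arrow.continuousAt.congr ?_
    filter_upwards [eventually_eventually_nhds.2 (hU x)] with y hy
    refine arrow_eq_of_eventuallyEq heff ?_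
    filter_upwards [hy, hU y] with z hz hz'
    rw [← hz, hz']
  have hr : ∀ x, ((U x).arrow x).right = h x := fun x => (hU x).self_of_nhds.symm
  obtain ⟨V, hV⟩ := exists_arrow_eq_section hσ (fun x => arrow_left _ x) h hr
  exact ⟨V, fun x => by rw [smul_eq, hV, hr]⟩

variable [CompactSpace X] [T2Space X] [TotallyDisconnectedSpace X]

/-- Extend `g` to arrows over a small clopen `B` whose ranges fill a disjoint clopen `C`; those
arrows, their inverses over `C` and units elsewhere form a global bisection. -/
theorem exists_smul_left_eq_right {g : Arr X} (hg : g.left ≠ g.right) :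
    ∃ U : FullGroup X, U • g.left = g.right := by
  classical
  obtain ⟨e, hge, he⟩ := IsEtaleGroupoid.isLocalHomeomorph_source (X := X) g
  obtain ⟨e', hge', he'⟩ := IsEtaleGroupoid.isLocalHomeomorph_range (X := X) g
  replace he : ∀ k, e k = k.left := fun k => (congrFun he k).symm
  replace he' : ∀ k, e' k = k.right := fun k => (congrFun he' k).symm
  have hgl : e.symm g.left = g := by rw [← he, e.left_inv hge]
  obtain ⟨P, Q, hP, hQ, hgP, hgQ, hPQ⟩ := t2_separation hg
  have hNo : IsOpen (e'.source ∩ (fun k : Arr X => k.right) ⁻¹' Q) :=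
    e'.open_source.inter (hQ.preimage IsTopologicalGroupoid.continuous_range)
  obtain ⟨B, hB, hgB, hBO⟩ := compact_exists_isClopen_in_isOpen
    ((e.isOpen_inter_preimage_symm hNo).inter hP)
    (x := g.left) ⟨⟨he g ▸ e.map_source hge, by
      rw [Set.mem_preimage, hgl]; exact ⟨hge', hgQ⟩⟩, hgP⟩
  have hBt : B ⊆ e.target := fun y hy => (hBO hy).1.1
  have hBs : ∀ y ∈ B, e.symm y ∈ e'.source := fun y hy => (hBO hy).1.2.1
  have hl : ∀ y ∈ B, (e.symm y).left = y := fun y hy => by rw [← he, e.right_inv (hBt hy)]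
  let C : Set X := e' '' (e.symm '' B)
  have hK : e.symm '' B ⊆ e'.source := by
    rintro _ ⟨y, hy, rfl⟩
    exact hBs y hy
  have hC : IsClopen C := by
    constructor
    · exact ((hB.isClosed.isCompact.image_of_continuousOn
        (e.continuousOn_symm.mono hBt)).image_of_continuousOn
          (e'.continuousOn.mono hK)).isClosed
    · exact e'.isOpen_image_of_subset_source
        (e.symm.isOpen_image_of_subset_source hB.isOpen hBt) hK
  have hBC : ∀ y ∈ B, (e.symm y).right ∈ C := fun y hy =>
    ⟨_, ⟨y, hy, rfl⟩, he' _⟩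
  have hCB : ∀ z ∈ C, z ∉ B := by
    rintro _ ⟨_, ⟨y, hy, rfl⟩, rfl⟩ hz
    rw [he'] at hz
    exact hPQ.le_bot ⟨(hBO hz).2, (hBO hy).1.2.2⟩
  have hs' : ∀ y ∈ B, e'.symm (e.symm y).right = e.symm y := fun y hy => by
    rw [← he', e'.left_inv (hBs y hy)]
  have hCt : C ⊆ e'.target := by
    rintro _ ⟨_, ⟨y, hy, rfl⟩, rfl⟩
    exact e'.map_source (hBs y hy)
  have hCl : ∀ z ∈ C, ∃ y ∈ B, e.symm y = e'.symm z ∧ z = (e.symm y).right := by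
    rintro _ ⟨_, ⟨y, hy, rfl⟩, rfl⟩
    exact ⟨y, hy, (e'.left_inv (hBs y hy)).symm, he' _⟩
  let σ : X → Arr X := fun z =>
    if z ∈ B then e.symm z else if z ∈ C then inv (e'.symm z) else unit z
  have σ₁ : ∀ z ∈ B, σ z = e.symm z := fun z hz => if_pos hz
  have σ₂ : ∀ z ∈ C, σ z = inv (e'.symm z) := fun z hz => by simp [σ, hCB z hz, hz]
  have σ₃ : ∀ z ∉ B, z ∉ C → σ z = unit z := fun z h h' => by simp [σ, h, h']
  have hσl : ∀ z, (σ z).left = z := by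
    intro z
    by_cases h : z ∈ B
    · rw [σ₁ z h, hl z h]
    by_cases h' : z ∈ C
    · obtain ⟨y, hy, hyz, e₁⟩ := hCl z h'
      rw [σ₂ z h', ← hyz, inv_left, ← e₁]
    · rw [σ₃ z h h', unit_left]
  have hσr : Function.Involutive fun z => (σ z).right := by
    intro z
    by_cases h : z ∈ B
    · simp only [σ₁ z h, σ₂ _ (hBC z h), hs' z h, inv_right, hl z h]
    by_cases h' : z ∈ C
    · obtain ⟨y, hy, hyz, e₁⟩ := hCl z h'
      simp only [σ₂ z h', ← hyz, inv_right, hl y hy, σ₁ y hy, ← e₁]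
    · simp only [σ₃ z h h', unit_right]
  have hσ : Continuous σ := by
    rw [continuous_iff_continuousAt]
    intro z
    by_cases h : z ∈ B
    · exact (e.continuousAt_symm (hBt h)).congr
        (Filter.mem_of_superset (hB.isOpen.mem_nhds h) fun w hw => (σ₁ w hw).symm)
    by_cases h' : z ∈ C
    · exact (IsTopologicalGroupoid.continuous_inv.continuousAt.comp
        (e'.continuousAt_symm (hCt h'))).congr
        (Filter.mem_of_superset (hC.isOpen.mem_nhds h') fun w hw => (σ₂ w hw).symm)
    · refine (IsTopologicalGroupoid.continuous_unit (X := X)).continuousAt.congr ?_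
      filter_upwards [hB.compl.isOpen.mem_nhds h, hC.compl.isOpen.mem_nhds h'] with w hw hw'
      exact (σ₃ w hw hw').symm
  have hσc : Continuous fun z => (σ z).right := IsTopologicalGroupoid.continuous_range.comp hσ
  obtain ⟨U, hU⟩ := exists_arrow_eq_section hσ hσl ⟨hσr.toPerm, hσc, hσc⟩ fun _ => rfl
  refine ⟨U, ?_⟩
  rw [smul_eq, hU, σ₁ _ hgB, hgl]

theorem isFullAction (heff : IsEffective X) (hpi : IsPurelyInfinite X) :
    IsFullAction (FullGroup X) X where
  isOpen_closedSupport U := by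
    rw [closedSupport_eq heff]
    exact ((isGlobalBisection_unit X).isClopen.preimage U.continuous_arrow).compl.isOpen
  exists_of_locally := exists_of_locally heff
  exists_smul_mem_ne x A hA := by
    obtain ⟨O, hOA, hO, hxO⟩ := mem_nhds_iff.1 hA
    obtain ⟨B, hB, hxB, hBO⟩ := compact_exists_isClopen_in_isOpen hO hxO
    -- Two arrows leave `x` for disjoint subsets of `B`, so at least one does not return to `x`.
    obtain ⟨U, V, -, -, -, -, hU, hV, hUV, hd⟩ := hpi B hB
    obtain ⟨g, hg, hgx⟩ : x ∈ (fun g : Arr X => g.left) '' U := hU ▸ hxB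
    obtain ⟨g', hg', hgx'⟩ : x ∈ (fun g : Arr X => g.left) '' V := hV ▸ hxB
    have key : ∀ k : Arr X, k.left = x → k.right ∈ B → k.right ≠ x →
        ∃ f : FullGroup X, f • x ∈ A ∧ f • x ≠ x := by
      rintro k rfl hkB hk
      obtain ⟨f, hf⟩ := exists_smul_left_eq_right hk.symm
      exact ⟨f, hf ▸ hOA (hBO hkB), hf ▸ hk⟩
    by_cases h : g.right = x
    · refine key g' hgx' (hUV (Or.inr ⟨g', hg', rfl⟩)) fun h' => ?_
      exact hd.le_bot ⟨⟨g, hg, h⟩, ⟨g', hg', h'⟩⟩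
    · exact key g hgx (hUV (Or.inl ⟨g, hg, rfl⟩)) h

end FullGroup

end Sections

end AmpleGroupoid

/-! ### Assembly of the theorem -/

open AmpleGroupoid in
theorem corollary6p4 (X : Type*) [CategoryTheory.Groupoid X]
    [TopologicalSpace X] [TopologicalSpace (Arr X)]
    [SecondCountableTopology (Arr X)] [LocallyCompactSpace (Arr X)] [T2Space (Arr X)]
    [IsEtaleGroupoid X]
    (hmin : IsMinimal X) (heff : IsEffective X)
    (hCantor : Nonempty (X ≃ₜ (ℕ → Bool)))
    (hpi : IsPurelyInfinite X) :
    -- restriction of automorphisms from the full group to its commutator subgroup is bijective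
    Function.Bijective
      (MulAut.characteristic (commutator (FullGroup X)) :
        MulAut (FullGroup X) →* MulAut (commutator (FullGroup X))) ∧
    -- the second map of the sequence is the one induced by the inverse of the restriction map
    ∃ π : OuterAut (commutator (FullGroup X)) →* OuterAut (FullGroup X),
      (∀ φ : MulAut (FullGroup X),
        π (QuotientGroup.mk (MulAut.characteristic (commutator (FullGroup X)) φ)) =
          QuotientGroup.mk φ) ∧
      Function.Injective (conjOut (FullGroup X)) ∧
      Function.MulExact (conjOut (FullGroup X)) π ∧
      Function.Surjective π := by
  obtain ⟨c⟩ := hCantor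
  have : CompactSpace X := c.symm.compactSpace
  have : T2Space X := c.isEmbedding.t2Space
  have : TotallyDisconnectedSpace X :=
    c.isEmbedding.isTotallyDisconnected_range.1 (isTotallyDisconnected_of_totallyDisconnectedSpace _)
  have : FaithfulSMul (FullGroup X) X := FullGroup.faithfulSMul heff
  have hF : IsFullAction (FullGroup X) X := FullGroup.isFullAction heff hpi
  have hc : ∀ u : FullGroup X, (∀ d ∈ commutator (FullGroup X), Commute u d) → u = 1 :=
    fun u hu => hF.eq_one_of_commute_commutator hu
  have hb : Function.Bijective (MulAut.characteristic (commutator (FullGroup X)) :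
      MulAut (FullGroup X) →* MulAut (commutator (FullGroup X))) := by
    refine ⟨characteristic_commutator_injective hc, fun ψ => ?_⟩
    obtain ⟨Φ, hΦ⟩ := hF.exists_extension ψ
    refine ⟨Φ, ?_⟩
    exact MulEquiv.ext fun d => Subtype.ext (hΦ d)
  obtain ⟨π, h₁, h₂, h₃⟩ := exists_exact_of_bijective_characteristic hb
  exact ⟨hb, π, h₁, conjOut_injective hc, h₂, h₃⟩
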